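/- Let $(\Omega,\mu)$ be a probability space and let $\{\phi_j\}_{j\in I}$ be an orthonormal system of complex-valued functions in $L^2(\Omega,\mu)$ which is uniformly bounded, $|\phi_j|\le M$ for all $j$. A family $\{\psi_j\}_{j\in I}$ of bounded complex-valued functions on a set $X$ is called Rademacher–Sidon with constant $\gamma>0$ if $$\int \sup_{x\in X}\Big|\sum_{j} r_j(\omega)\,a_j\,\psi_j(x)\Big|\,d\omega\;\ge\;\gamma\sum_{j}|a_j|$$ for every finitely supported family of complex numbers $\{a_j\}$, where the $r_j$ are independent Rademacher functions (independent random variables with values $\pm1$, each with probability $\tfrac12$). For $k\ge 1$ the $k$-fold tensor system $\{\phi_j\otimes\cdots\otimes\phi_j\}_{j\in I}$ consists of the functions $(x_1,\dots,x_k)\mapsto\prod_{s=1}^k\phi_j(x_s)$ on $\Omega^k$ with the product measure. Theorem. For every $k\ge1$, $M$ and $c>0$ there is a constant $\gamma=\gamma(k,M,c)>0$ such that, for every probability space $(\Omega,\mu)$ and every orthonormal system $\{\phi_j\}$ on it that is uniformly bounded by $M$: if the $k$-fold tensor system is Rademacher–Sidon with constant $c$, then $\{\phi_j\}$ is Rademacher–Sidon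 with constant $\gamma$. This holds both when the bound by $M$ and the suprema are understood pointwise (everywhere on $\Omega$ and $\Omega^k$), and when they are understood almost everywhere (as bounds and norms in $L^\infty(\Omega)$ and $L^\infty(\Omega^k)$). -/

import Mathlib

open MeasureTheory
open scoped ENNReal ComplexConjugate

/-- A family of complex-valued square-integrable functions that is orthonormal in `L²(μ)`. -/
structure IsOrthonormalSystem {ι Ω : Type*} [MeasurableSpace Ω] (μ : Measure Ω)
    (φ : ι → Ω → ℂ) : Prop where
  memLp : ∀ j, MemLp (φ j) 2 μ
  norm_one : ∀ j, ∫ x, φ j x * conj (φ j x) ∂μ = 1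
  orthogonal : ∀ i j, i ≠ j → ∫ x, φ i x * conj (φ j x) ∂μ = 0

/-- The `k`-fold tensor system `φ_j ⊗ ⋯ ⊗ φ_j` on `Ω ^ k`. -/
def tensorSystem {ι Ω : Type*} (k : ℕ) (φ : ι → Ω → ℂ) : ι → (Fin k → Ω) → ℂ :=
  fun j x => ∏ s, φ j (x s)

/-- The pointwise supremum `sup_x |f x|`, with values in `[0, ∞]`. -/
noncomputable def supNorm {X : Type*} (f : X → ℂ) : ℝ≥0∞ := ⨆ x, ‖f x‖ₑ

/-- The essential supremum of `|f|`, that is, the `L^∞(μ)` norm. -/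
noncomputable def essSupNorm {X : Type*} [MeasurableSpace X] (μ : Measure X)
    (f : X → ℂ) : ℝ≥0∞ := eLpNorm f ∞ μ

open scoped Classical in
/-- The expectation of `N (∑_{j ∈ s} r_j a_j φ_j)` where the `r_j`, `j ∈ s`, are independent
Rademacher variables: the vector `(r_j)` is uniformly distributed on the `2 ^ |s|` sign
patterns. -/
noncomputable def rademacherAverage {ι X : Type*} (N : (X → ℂ) → ℝ≥0∞) (φ : ι → X → ℂ)
    (s : Finset ι) (a : ι → ℂ) : ℝ≥0∞ :=
  (∑ r : s → ℤˣ, N (fun x => ∑ j : s, ((r j : ℤ) : ℂ) * a j * φ j x)) / 2 ^ s.card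

/-- The Rademacher–Sidon inequality with constant `γ` for all finite systems of coefficients,
where `N` is the supremum norm that is used (pointwise or essential). -/
def IsRademacherSidonWith {ι X : Type*} (N : (X → ℂ) → ℝ≥0∞) (γ : ℝ) (φ : ι → X → ℂ) : Prop :=
  ∀ (s : Finset ι) (a : ι → ℂ),
    ENNReal.ofReal (γ * ∑ j ∈ s, ‖a j‖) ≤ rademacherAverage N φ s a

/-! The two Rademacher averages are compared directly: the tensor average is at most `16 k² M^k`
times the average for `φ`, taking `M ≥ 1`. On the disc of radius `M` a product of `k` factors is
Lipschitz, so increments of `a_j ∏ φ_j(x_s)` are dominated by sums of increments of the `a_j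
φ_j(x_s)`. A vector contraction principle (`sum_rademacher_le_of_increments`) turns this into a
comparison of expected suprema: each sign times a product is exchanged for a sum over `s` with
independent signs, one index `j` at a time. The triangle inequality then separates the coordinates,
each giving a Rademacher sum of the original system. -/

/-! ### Vector contraction for Rademacher averages. -/

section Contraction

variable {J κ Y E T : Type*} [Fintype J] [DecidableEq J] [Fintype κ] [DecidableEq κ]
  [Fintype Y] [Fintype E]

/-- Resampling one coordinate does not change the average over a finite product. -/
theorem sum_sum_update (s : κ) (Ψ : (κ → Y) → ℝ) :
    ∑ e, ∑ u, Ψ (Function.update e s u) = Fintype.card Y * ∑ e, Ψ e := by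
  have h : ∑ p : (κ → Y) × Y, Ψ (Function.update p.1 s p.2) = ∑ p : (κ → Y) × Y, Ψ p.1 := by
    let σ : (κ → Y) × Y → (κ → Y) × Y := fun p => (Function.update p.1 s p.2, p.1 s)
    have hσ : Function.Involutive σ := fun p => by simp [σ]
    exact Fintype.sum_bijective σ hσ.bijective _ _ fun p => rfl
  rw [← Fintype.sum_prod_type' (f := fun e u => Ψ (Function.update e s u)), h,
    Fintype.sum_prod_type]
  simp [Finset.mul_sum]

/-- The average over a finite product of a function of one coordinate. -/
theorem card_mul_sum_eval (s : κ) (Ψ : Y → ℝ) :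
    Fintype.card Y * ∑ e : κ → Y, Ψ (e s) = Fintype.card (κ → Y) * ∑ u, Ψ u := by
  rw [← sum_sum_update s fun e : κ → Y => Ψ (e s)]
  simp

theorem le_iSup_of_finite [Finite T] (f : T → ℝ) (t : T) : f t ≤ ⨆ t, f t :=
  le_ciSup (Set.finite_range f).bddAbove t

/-- Expected suprema may be compared by replacing the independent summands one at a time. -/
theorem sum_iSup_sum_le [Finite T] [Nonempty E] (p q : J → E → T → ℝ)
    (hpq : ∀ j (F : T → ℝ), ∑ e, ⨆ t, (F t + p j e t) ≤ ∑ e, ⨆ t, (F t + q j e t)) :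
    ∑ e : J → E, ⨆ t, ∑ j, p j (e j) t ≤ ∑ e : J → E, ⨆ t, ∑ j, q j (e j) t := by
  -- Hybrid argument: `A` is the set of indices already switched from `p` to `q`. Resampling
  -- coordinate `i` isolates its summand, the rest being the fixed `F`.
  have key : ∀ A : Finset J, ∑ e : J → E, ⨆ t, ∑ j, p j (e j) t ≤
      ∑ e : J → E, ⨆ t, ∑ j, (if j ∈ A then q j (e j) t else p j (e j) t) := by
    intro A
    induction A using Finset.induction_on with
    | empty => simp
    | insert i A hi ih =>
      refine ih.trans ?_
      have hE : (0 : ℝ) < Fintype.card E := by exact_mod_cast Fintype.card_pos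
      refine le_of_mul_le_mul_left ?_ hE
      rw [← sum_sum_update i, ← sum_sum_update i]
      refine Finset.sum_le_sum fun e _ => ?_
      let F : T → ℝ := fun t =>
        ∑ j ∈ Finset.univ.erase i, if j ∈ A then q j (e j) t else p j (e j) t
      have hold : ∀ u t, (∑ j, if j ∈ A then q j (Function.update e i u j) t
          else p j (Function.update e i u j) t) = F t + p i u t := by
        intro u t
        rw [← Finset.sum_erase_add _ _ (Finset.mem_univ i)]
        congr 1
        · refine Finset.sum_congr rfl fun j hj => ?_
          rw [Function.update_of_ne (Finset.ne_of_mem_erase hj)]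
        · simp [hi]
      have hnew : ∀ u t, (∑ j, if j ∈ insert i A then q j (Function.update e i u j) t
          else p j (Function.update e i u j) t) = F t + q i u t := by
        intro u t
        rw [← Finset.sum_erase_add _ _ (Finset.mem_univ i)]
        congr 1
        · refine Finset.sum_congr rfl fun j hj => ?_
          simp [Finset.ne_of_mem_erase hj]
        · simp
      simp only [hold, hnew]
      exact hpq i F
  simpa using key Finset.univ

/-- Every coefficient of a Rademacher sum is bounded by its first absolute moment. -/
theorem card_mul_abs_le_sum_abs (v : κ → ℝ) (s : κ) :
    Fintype.card (κ → ℤˣ) * |v s| ≤ ∑ e : κ → ℤˣ, |∑ i, ((e i : ℤ) : ℝ) * v i| := by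
  -- Flipping the sign at `s` changes the sum by `±2 v s`.
  let σ : (κ → ℤˣ) → (κ → ℤˣ) := fun e => Function.update e s (-e s)
  have hσ : Function.Involutive σ := fun e => by simp [σ]
  let X : (κ → ℤˣ) → ℝ := fun e => ∑ i, ((e i : ℤ) : ℝ) * v i
  have h1 : ∑ e, |X (σ e)| = ∑ e, |X e| :=
    Fintype.sum_bijective σ hσ.bijective _ _ fun e => rfl
  have h2 : ∀ e, 2 * |v s| ≤ |X e| + |X (σ e)| := by
    intro e
    have h3 : X e - X (σ e) = 2 * (((e s : ℤ) : ℝ) * v s) := by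
      simp only [X]
      rw [← Finset.sum_sub_distrib, Finset.sum_eq_single s]
      · simp [σ]; ring
      · intro i _ hi
        simp [σ, hi]
      · simp
    have h4 : |((e s : ℤ) : ℝ) * v s| = |v s| := by
      rcases Int.units_eq_one_or (e s) with h | h <;> simp [h]
    calc 2 * |v s| = |X e - X (σ e)| := by rw [h3, abs_mul, h4]; simp
      _ ≤ _ := abs_sub _ _
  have h5 := Finset.sum_le_sum fun e (_ : e ∈ (Finset.univ : Finset (κ → ℤˣ))) => h2 e
  rw [Finset.sum_add_distrib, h1] at h5
  simp only [Finset.sum_const, Finset.card_univ, nsmul_eq_mul] at h5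
  change _ ≤ ∑ e, |X e|
  linarith

/-- A random sign in front of a function `h` may be replaced by a Rademacher sum of functions
that control the increments of `h`. -/
theorem sum_iSup_add_sign_mul_le [Finite T] [Nonempty T] (s₀ : κ) (F h : T → ℝ) (f : κ → T → ℝ)
    (hf : ∀ t t', h t - h t' ≤ ∑ s, |f s t - f s t'|) :
    ∑ e : κ → ℤˣ, ⨆ t, (F t + ((e s₀ : ℤ) : ℝ) * h t) ≤
      ∑ e : κ → ℤˣ, ⨆ t, (F t + Fintype.card κ * ∑ s, ((e s : ℤ) : ℝ) * f s t) := by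
  have hneg : ∀ Ψ : (κ → ℤˣ) → ℝ, ∑ e, Ψ (-e) = ∑ e, Ψ e := fun Ψ =>
    Fintype.sum_bijective _ (Equiv.neg (κ → ℤˣ)).bijective _ _ fun e => rfl
  let P : (κ → ℤˣ) → ℝ := fun e => ⨆ t, (F t + ((e s₀ : ℤ) : ℝ) * h t)
  let g : (κ → ℤˣ) → T → ℝ := fun e t => Fintype.card κ * ∑ s, ((e s : ℤ) : ℝ) * f s t
  let Q : (κ → ℤˣ) → ℝ := fun e => ⨆ t, (F t + g e t)
  change ∑ e, P e ≤ ∑ e, Q e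
  have hgneg : ∀ e t, g (-e) t = - g e t := fun e t => by simp [g]
  -- The signs `e` and `-e` are paired. The maximisers of `F + h` and `F - h` compute the left side
  -- exactly and serve as test points on the right.
  obtain ⟨t, ht⟩ := exists_eq_ciSup_of_finite (f := fun t => F t + h t)
  obtain ⟨t', ht'⟩ := exists_eq_ciSup_of_finite (f := fun t => F t - h t)
  have hP : ∀ e, P e + P (-e) = F t + F t' + (h t - h t') := by
    intro e
    have hs : (⨆ t, (F t + h t)) + ⨆ t, (F t - h t) = F t + F t' + (h t - h t') := by
      rw [← ht, ← ht']; ring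
    rcases Int.units_eq_one_or (e s₀) with h' | h'
    · simpa [P, h', ← sub_eq_add_neg] using hs
    · rw [add_comm] at hs
      simpa [P, h', ← sub_eq_add_neg] using hs
  have hQ : ∀ e, F t + F t' + |g e t - g e t'| ≤ Q e + Q (-e) := by
    intro e
    have a1 := le_iSup_of_finite (fun t => F t + g e t) t
    have a2 := le_iSup_of_finite (fun t => F t + g e t) t'
    have a3 := le_iSup_of_finite (fun t => F t + g (-e) t) t
    have a4 := le_iSup_of_finite (fun t => F t + g (-e) t) t'
    simp only [hgneg] at a3 a4
    simp only [Q, hgneg]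
    rcases abs_cases (g e t - g e t') with ⟨h', _⟩ | ⟨h', _⟩ <;> rw [h'] <;> linarith
  -- Each of the `|κ|` increments is at most the first moment of the same Rademacher sum, so adding
  -- them costs the factor `|κ|` built into `g`.
  have habs : Fintype.card (κ → ℤˣ) * ∑ s, |f s t - f s t'| ≤ ∑ e, |g e t - g e t'| := by
    have h1 : ∀ e, |g e t - g e t'| =
        Fintype.card κ * |∑ s, ((e s : ℤ) : ℝ) * (f s t - f s t')| := by
      intro e
      simp only [g, ← mul_sub, ← Finset.sum_sub_distrib]
      rw [abs_mul, Nat.abs_cast]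
    simp only [h1, ← Finset.mul_sum]
    rw [Finset.mul_sum]
    refine (Finset.sum_le_sum fun s _ =>
      card_mul_abs_le_sum_abs (fun s => f s t - f s t') s).trans ?_
    simp
  have hPs : ∑ e, (P e + P (-e)) = 2 * ∑ e, P e := by
    rw [Finset.sum_add_distrib, hneg]; ring
  have hQs : ∑ e, (Q e + Q (-e)) = 2 * ∑ e, Q e := by
    rw [Finset.sum_add_distrib, hneg]; ring
  have hQs' := Finset.sum_le_sum fun e (_ : e ∈ (Finset.univ : Finset (κ → ℤˣ))) => hQ e
  rw [hQs, Finset.sum_add_distrib] at hQs'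
  simp only [hP] at hPs
  simp only [Finset.sum_const, Finset.card_univ, nsmul_eq_mul] at hPs hQs'
  have h6 := mul_le_mul_of_nonneg_left (hf t t')
    (Nat.cast_nonneg (α := ℝ) (Fintype.card (κ → ℤˣ)))
  linarith

/-- A vector contraction principle for Rademacher averages, for a choice `τ` of points. -/
theorem sum_rademacher_le_of_increments [Finite T] [Nonempty T] [Nonempty κ]
    (h : J → T → ℝ) (f : J → κ → T → ℝ)
    (hf : ∀ j t t', h j t - h j t' ≤ ∑ s, |f j s t - f j s t'|)
    (B : (J → ℤˣ) → ℝ) (hB : ∀ r s t, ∑ j, ((r j : ℤ) : ℝ) * f j s t ≤ B r)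
    (τ : (J → ℤˣ) → T) :
    ∑ r : J → ℤˣ, ∑ j, ((r j : ℤ) : ℝ) * h j (τ r) ≤
      (Fintype.card κ : ℝ) ^ 2 * ∑ r, B r := by
  obtain ⟨s₀⟩ := ‹Nonempty κ›
  have h1 := sum_iSup_sum_le (E := κ → ℤˣ) (fun j e t => ((e s₀ : ℤ) : ℝ) * h j t)
    (fun j e t => Fintype.card κ * ∑ s, ((e s : ℤ) : ℝ) * f j s t)
    (fun j F => sum_iSup_add_sign_mul_le s₀ F (h j) (f j) (hf j))
  have hswap : ∀ Ψ : (κ → J → ℤˣ) → ℝ,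
      ∑ e : J → κ → ℤˣ, Ψ (fun s j => e j s) = ∑ e, Ψ e := fun Ψ =>
    Fintype.sum_equiv (Equiv.piComm fun _ _ => ℤˣ) _ _ fun e => rfl
  have hc : (0 : ℝ) < Fintype.card (J → ℤˣ) := by exact_mod_cast Fintype.card_pos
  have hd : (0 : ℝ) < Fintype.card (κ → J → ℤˣ) := by exact_mod_cast Fintype.card_pos
  -- Each column `e · s` is itself uniformly distributed over sign patterns. The left side sees only
  -- column `s₀`; summing over columns on the right gives the second factor `|κ|`.
  have hmarg : ∀ (s : κ) (Ψ : (J → ℤˣ) → ℝ),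
      Fintype.card (J → ℤˣ) * ∑ e : J → κ → ℤˣ, Ψ (fun j => e j s) =
        Fintype.card (κ → J → ℤˣ) * ∑ r, Ψ r := by
    intro s Ψ
    rw [hswap fun e => Ψ (e s), card_mul_sum_eval]
  have hleft : ∑ e : J → κ → ℤˣ, ∑ j, ((e j s₀ : ℤ) : ℝ) * h j (τ fun j => e j s₀) ≤
      ∑ e : J → κ → ℤˣ, ⨆ t, ∑ j, ((e j s₀ : ℤ) : ℝ) * h j t :=
    Finset.sum_le_sum fun e _ =>
      le_iSup_of_finite (fun t => ∑ j, ((e j s₀ : ℤ) : ℝ) * h j t) (τ fun j => e j s₀)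
  have hright : ∑ e : J → κ → ℤˣ,
      (⨆ t, ∑ j, Fintype.card κ * ∑ s, ((e j s : ℤ) : ℝ) * f j s t) ≤
      Fintype.card κ * ∑ s, ∑ e : J → κ → ℤˣ, B (fun j => e j s) := by
    rw [Finset.sum_comm, Finset.mul_sum]
    refine Finset.sum_le_sum fun e _ => ciSup_le fun t => ?_
    rw [← Finset.mul_sum, Finset.sum_comm]
    exact mul_le_mul_of_nonneg_left (Finset.sum_le_sum fun s _ => hB (fun j => e j s) s t)
      (Nat.cast_nonneg _)
  have h2 := mul_le_mul_of_nonneg_left (hleft.trans (h1.trans hright)) hc.le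
  rw [hmarg s₀ fun r => ∑ j, ((r j : ℤ) : ℝ) * h j (τ r), mul_left_comm,
    Finset.mul_sum Finset.univ _ (Fintype.card (J → ℤˣ) : ℝ), Finset.sum_congr rfl fun s _ => hmarg s B, Finset.sum_const, Finset.card_univ,
    nsmul_eq_mul] at h2
  refine le_of_mul_le_mul_left (h2.trans_eq ?_) hd
  ring

/-- The contraction principle with absolute values, for functions that may also be replaced
by zero. -/
theorem sum_abs_rademacher_le_of_increments [Nonempty κ]
    (h : J → T → ℝ) (f : J → κ → T → ℝ)
    (hf : ∀ j t t', |h j t - h j t'| ≤ ∑ s, |f j s t - f j s t'|)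
    (hf₀ : ∀ j t, |h j t| ≤ ∑ s, |f j s t|)
    (B : (J → ℤˣ) → ℝ) (hB₀ : ∀ r, 0 ≤ B r)
    (hB : ∀ r s t, ∑ j, ((r j : ℤ) : ℝ) * f j s t ≤ B r)
    (τ : (J → ℤˣ) → T) :
    ∑ r : J → ℤˣ, |∑ j, ((r j : ℤ) : ℝ) * h j (τ r)| ≤
      2 * ((Fintype.card κ : ℝ) ^ 2 * ∑ r, B r) := by
  have key : ∀ h : J → T → ℝ, (∀ j t t', |h j t - h j t'| ≤ ∑ s, |f j s t - f j s t'|) →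
      (∀ j t, |h j t| ≤ ∑ s, |f j s t|) →
      ∑ r : J → ℤˣ, max (∑ j, ((r j : ℤ) : ℝ) * h j (τ r)) 0 ≤
        (Fintype.card κ : ℝ) ^ 2 * ∑ r, B r := by
    intro h hf hf₀
    -- Only the finitely many points `τ r` matter. The extra point `none`, where all functions
    -- vanish, is chosen when the sum is negative, which produces the positive part.
    have := sum_rademacher_le_of_increments (T := Option (J → ℤˣ))
      (fun j t => t.elim 0 fun r => h j (τ r)) (fun j s t => t.elim 0 fun r => f j s (τ r))
      (by
        intro j t t'
        refine (le_abs_self _).trans ?_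
        cases t <;> cases t' <;> simp [hf, hf₀])
      B
      (by
        intro r s t
        cases t <;> simp [hB, hB₀])
      (fun r => if 0 ≤ ∑ j, ((r j : ℤ) : ℝ) * h j (τ r) then some r else none)
    refine (Finset.sum_le_sum fun r _ => ?_).trans this
    split_ifs with h'
    · simp [h']
    · simp [(not_le.mp h').le]
  have h1 := key h hf hf₀
  have h2 := key (fun j t => -h j t)
    (fun j t t' => by rw [← neg_sub', abs_neg]; exact hf j t t')
    (fun j t => by rw [abs_neg]; exact hf₀ j t)
  rw [two_mul]
  refine le_trans (le_of_eq ?_) (add_le_add h1 h2)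
  rw [← Finset.sum_add_distrib]
  refine Finset.sum_congr rfl fun r _ => ?_
  simp only [mul_neg, Finset.sum_neg_distrib]
  rw [← posPart_add_negPart]
  rfl

/-- The vector contraction principle for complex-valued functions. -/
theorem sum_norm_rademacher_le_of_increments [Nonempty κ]
    (H : J → T → ℂ) (Z : J → κ → T → ℂ) (L : ℝ) (hL : 0 ≤ L)
    (hH : ∀ j t t', ‖H j t - H j t'‖ ≤ L * ∑ s, ‖Z j s t - Z j s t'‖)
    (hH₀ : ∀ j t, ‖H j t‖ ≤ L * ∑ s, ‖Z j s t‖)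
    (B : (J → ℤˣ) → ℝ) (hB : ∀ r s t, ‖∑ j, ((r j : ℤ) : ℂ) * Z j s t‖ ≤ B r)
    (τ : (J → ℤˣ) → T) :
    ∑ r : J → ℤˣ, ‖∑ j, ((r j : ℤ) : ℂ) * H j (τ r)‖ ≤
      16 * (Fintype.card κ : ℝ) ^ 2 * L * ∑ r, B r := by
  let f : J → κ × Bool → T → ℝ := fun j p t =>
    L * bif p.2 then (Z j p.1 t).re else (Z j p.1 t).im
  have hsum : ∀ w : κ → ℂ, L * ∑ s, ‖w s‖ ≤
      ∑ p : κ × Bool, |L * bif p.2 then (w p.1).re else (w p.1).im| := by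
    intro w
    rw [Fintype.sum_prod_type, Finset.mul_sum]
    refine Finset.sum_le_sum fun s _ => ?_
    simp only [Fintype.sum_bool, cond_true, cond_false, abs_mul, abs_of_nonneg hL, ← mul_add]
    exact mul_le_mul_of_nonneg_left (Complex.norm_le_abs_re_add_abs_im _) hL
  have hdiff : ∀ j t t', L * ∑ s, ‖Z j s t - Z j s t'‖ ≤ ∑ p, |f j p t - f j p t'| := by
    intro j t t'
    refine (hsum fun s => Z j s t - Z j s t').trans_eq (Finset.sum_congr rfl fun p _ => ?_)
    obtain ⟨s, b⟩ := p
    cases b <;> simp [f, mul_sub]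
  have hzero : ∀ j t, L * ∑ s, ‖Z j s t‖ ≤ ∑ p, |f j p t| := fun j t => hsum fun s => Z j s t
  have hB₀ : ∀ r, 0 ≤ B r := by
    obtain ⟨s⟩ := ‹Nonempty κ›
    exact fun r => (norm_nonneg _).trans (hB r s (τ r))
  have hfB : ∀ (r : J → ℤˣ) p t, ∑ j, ((r j : ℤ) : ℝ) * f j p t ≤ L * B r := by
    rintro r ⟨s, b⟩ t
    simp only [f, mul_left_comm _ L, ← Finset.mul_sum]
    refine mul_le_mul_of_nonneg_left (le_trans ?_ (hB r s t)) hL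
    cases b
    · refine le_trans (le_of_eq ?_) ((le_abs_self _).trans (Complex.abs_im_le_norm _))
      simp
    · refine le_trans (le_of_eq ?_) ((le_abs_self _).trans (Complex.abs_re_le_norm _))
      simp
  have hre := sum_abs_rademacher_le_of_increments (fun j t => (H j t).re) f
    (fun j t t' => ((Complex.abs_re_le_norm (H j t - H j t')).trans (hH j t t')).trans
      (hdiff j t t'))
    (fun j t => ((Complex.abs_re_le_norm _).trans (hH₀ j t)).trans (hzero j t))
    (fun r => L * B r) (fun r => mul_nonneg hL (hB₀ r)) hfB τ
  have him := sum_abs_rademacher_le_of_increments (fun j t => (H j t).im) f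
    (fun j t t' => ((Complex.abs_im_le_norm (H j t - H j t')).trans (hH j t t')).trans
      (hdiff j t t'))
    (fun j t => ((Complex.abs_im_le_norm _).trans (hH₀ j t)).trans (hzero j t))
    (fun r => L * B r) (fun r => mul_nonneg hL (hB₀ r)) hfB τ
  have hnorm : ∀ r : J → ℤˣ, ‖∑ j, ((r j : ℤ) : ℂ) * H j (τ r)‖ ≤
      |∑ j, ((r j : ℤ) : ℝ) * (H j (τ r)).re| + |∑ j, ((r j : ℤ) : ℝ) * (H j (τ r)).im| := by
    intro r
    refine (Complex.norm_le_abs_re_add_abs_im _).trans_eq ?_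
    simp
  refine (Finset.sum_le_sum fun r _ => hnorm r).trans ?_
  rw [Finset.sum_add_distrib]
  refine (add_le_add hre him).trans_eq ?_
  -- `16 = 2 · 2 · 2²`: real and imaginary parts, positive and negative parts, and `|κ × Bool|² = 4
  -- |κ|²`.
  rw [← Finset.mul_sum, Fintype.card_prod, Fintype.card_bool]
  push_cast
  ring

end Contraction

/-! ### Application to tensor systems. -/

/-- A product of numbers bounded by `M` is Lipschitz in its factors. -/
theorem norm_prod_sub_prod_le {κ : Type*} (A : Finset κ) (M : ℝ) (hM : 1 ≤ M) (z w : κ → ℂ)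
    (hz : ∀ s, ‖z s‖ ≤ M) (hw : ∀ s, ‖w s‖ ≤ M) :
    ‖∏ s ∈ A, z s - ∏ s ∈ A, w s‖ ≤ M ^ A.card * ∑ s ∈ A, ‖z s - w s‖ := by
  classical
  have hM₀ : 0 ≤ M := zero_le_one.trans hM
  induction A using Finset.induction_on with
  | empty => simp
  | insert i A hi ih =>
    rw [Finset.prod_insert hi, Finset.prod_insert hi, Finset.sum_insert hi,
      Finset.card_insert_of_notMem hi]
    have h1 : ‖∏ s ∈ A, z s‖ ≤ M ^ A.card := by
      rw [norm_prod]
      exact (Finset.prod_le_prod (fun s _ => norm_nonneg _) fun s _ => hz s).trans_eq (by simp)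
    have h2 : M ^ A.card ≤ M ^ (A.card + 1) := pow_le_pow_right₀ hM (Nat.le_succ _)
    calc ‖z i * ∏ s ∈ A, z s - w i * ∏ s ∈ A, w s‖
        = ‖(z i - w i) * ∏ s ∈ A, z s + w i * (∏ s ∈ A, z s - ∏ s ∈ A, w s)‖ := by ring_nf
      _ ≤ ‖z i - w i‖ * ‖∏ s ∈ A, z s‖ + ‖w i‖ * ‖∏ s ∈ A, z s - ∏ s ∈ A, w s‖ := by
          refine (norm_add_le _ _).trans ?_
          rw [norm_mul, norm_mul]
      _ ≤ ‖z i - w i‖ * M ^ (A.card + 1) + M * (M ^ A.card * ∑ s ∈ A, ‖z s - w s‖) := by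
          gcongr
          · exact h1.trans h2
          · exact hw i
      _ = _ := by ring

/-- A finite sum of suprema is the supremum over all choices of points. -/
theorem sum_iSup_le_of_forall_choice {R X : Type*} [Nonempty X] (A : Finset R)
    (f : R → X → ℝ≥0∞) (C : ℝ≥0∞) (h : ∀ τ : R → X, ∑ r ∈ A, f r (τ r) ≤ C) :
    ∑ r ∈ A, ⨆ x, f r x ≤ C := by
  classical
  suffices hA : ∑ r ∈ A, ⨆ x, f r x ≤ ⨆ τ : R → X, ∑ r ∈ A, f r (τ r) from hA.trans (iSup_le h)
  clear h
  induction A using Finset.induction_on with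
  | empty => simp
  | insert i A hi ih =>
    rw [Finset.sum_insert hi]
    refine (add_le_add le_rfl ih).trans ?_
    rw [ENNReal.iSup_add]
    refine iSup_le fun x => ?_
    rw [ENNReal.add_iSup]
    refine iSup_le fun τ => le_iSup_of_le (Function.update τ i x) ?_
    rw [Finset.sum_insert hi, Function.update_self]
    refine add_le_add le_rfl (le_of_eq (Finset.sum_congr rfl fun r hr => ?_))
    rw [Function.update_of_ne (ne_of_mem_of_not_mem hr hi)]

/-- The expected supremum of a random tensor sum is controlled by bounds for the random sums of
the system itself. -/
theorem sum_iSup_tensorSystem_le {ι X : Type*} [Nonempty X] (k : ℕ) (hk : 1 ≤ k) (M : ℝ)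
    (hM : 1 ≤ M) (s : Finset ι) [DecidableEq s] (a : ι → ℂ) (φ : ι → X → ℂ)
    (hφ : ∀ j ∈ s, ∀ x, ‖φ j x‖ ≤ M) (N : (s → ℤˣ) → ℝ≥0∞)
    (hN : ∀ (r : s → ℤˣ) x, ‖∑ j : s, ((r j : ℤ) : ℂ) * a j * φ j x‖ₑ ≤ N r) :
    ∑ r : s → ℤˣ, ⨆ x, ‖∑ j : s, ((r j : ℤ) : ℂ) * a j * tensorSystem k φ j x‖ₑ ≤
      ENNReal.ofReal (16 * (k : ℝ) ^ 2 * M ^ k) * ∑ r, N r := by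
  have hM₀ : 0 < M := zero_lt_one.trans_le hM
  have hk₀ : (0 : ℝ) < k := by exact_mod_cast hk
  by_cases htop : ∃ r, N r = ∞
  · have : ∑ r, N r = ∞ := ENNReal.sum_eq_top.mpr ⟨_, Finset.mem_univ _, htop.choose_spec⟩
    rw [this, ENNReal.mul_top]
    · exact le_top
    · rw [ne_eq, ENNReal.ofReal_eq_zero, not_le]
      positivity
  push Not at htop
  have : Nonempty (Fin k) := ⟨⟨0, hk⟩⟩
  refine sum_iSup_le_of_forall_choice _ _ _ fun τ => ?_
  have key := sum_norm_rademacher_le_of_increments (J := s) (κ := Fin k) (T := Fin k → X)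
    (fun j x => a j * tensorSystem k φ j x) (fun j i x => a j * φ j (x i)) (M ^ k) (by positivity)
    (by
      intro j x y
      have := norm_prod_sub_prod_le Finset.univ M hM (fun i => φ j (x i)) (fun i => φ j (y i))
        (fun i => hφ j j.2 _) (fun i => hφ j j.2 _)
      rw [Finset.card_univ, Fintype.card_fin] at this
      simp only [tensorSystem, ← mul_sub, norm_mul, ← Finset.mul_sum]
      rw [mul_left_comm]
      exact mul_le_mul_of_nonneg_left this (norm_nonneg _))
    (by
      intro j x
      -- Comparison with the zero vector, whose product is `0` because `k ≥ 1`.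
      have := norm_prod_sub_prod_le Finset.univ M hM (fun i => φ j (x i)) (fun _ => 0)
        (fun i => hφ j j.2 _) (fun i => by simpa using hM₀.le)
      rw [Finset.card_univ, Fintype.card_fin, Finset.prod_const, Finset.card_univ,
        Fintype.card_fin, zero_pow (by omega)] at this
      simp only [sub_zero] at this
      simp only [tensorSystem, norm_mul, ← Finset.mul_sum] at this ⊢
      rw [mul_left_comm]
      exact mul_le_mul_of_nonneg_left this (norm_nonneg _))
    (fun r => (N r).toReal)
    (by
      intro r i x
      have := ENNReal.toReal_mono (htop r) (hN r (x i))
      simpa [mul_assoc] using this)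
    τ
  rw [Fintype.card_fin, ← ENNReal.toReal_sum fun r _ => htop r] at key
  have hle := ENNReal.ofReal_le_ofReal key
  rw [ENNReal.ofReal_mul (by positivity),
    ENNReal.ofReal_toReal (ENNReal.sum_ne_top.mpr fun r _ => htop r),
    ENNReal.ofReal_sum_of_nonneg fun r _ => norm_nonneg _] at hle
  refine le_trans (le_of_eq (Finset.sum_congr rfl fun r _ => ?_)) hle
  rw [ofReal_norm]
  simp only [mul_assoc]

/-! ### Transfer of the Sidon property, pointwise and almost everywhere. -/

/-- A comparison of Rademacher averages transfers the Rademacher–Sidon property. -/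
theorem IsRademacherSidonWith.of_le {ι X Y : Type*} {N : (X → ℂ) → ℝ≥0∞} {N' : (Y → ℂ) → ℝ≥0∞}
    {φ : ι → X → ℂ} {ψ : ι → Y → ℂ} {c C : ℝ} (hC : 0 < C) (h : IsRademacherSidonWith N c φ)
    (hle : ∀ s a, rademacherAverage N φ s a ≤ ENNReal.ofReal C * rademacherAverage N' ψ s a) :
    IsRademacherSidonWith N' (c / C) ψ := by
  intro s a
  have h1 := (h s a).trans (hle s a)
  have h2 : c * ∑ j ∈ s, ‖a j‖ = C * (c / C * ∑ j ∈ s, ‖a j‖) := by field_simp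
  rw [h2, ENNReal.ofReal_mul hC.le] at h1
  exact (ENNReal.mul_le_mul_iff_right (by simpa using hC) ENNReal.ofReal_ne_top).mp h1

theorem rademacherAverage_supNorm_tensorSystem_le {ι X : Type*} [Nonempty X] (k : ℕ)
    (hk : 1 ≤ k) (M : ℝ) (hM : 1 ≤ M) (φ : ι → X → ℂ) (hφ : ∀ j x, ‖φ j x‖ ≤ M)
    (s : Finset ι) (a : ι → ℂ) :
    rademacherAverage supNorm (tensorSystem k φ) s a ≤
      ENNReal.ofReal (16 * (k : ℝ) ^ 2 * M ^ k) * rademacherAverage supNorm φ s a := by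
  classical
  unfold rademacherAverage
  rw [← mul_div_assoc]
  refine ENNReal.div_le_div_right ?_ _
  exact sum_iSup_tensorSystem_le k hk M hM s a φ (fun j _ => hφ j) _ fun r x =>
    le_iSup (fun x => ‖∑ j : s, ((r j : ℤ) : ℂ) * a j * φ j x‖ₑ) x

theorem rademacherAverage_essSupNorm_tensorSystem_le {ι Ω : Type*} [MeasurableSpace Ω]
    (μ : Measure Ω) [IsProbabilityMeasure μ] (k : ℕ)
    (hk : 1 ≤ k) (M : ℝ) (hM : 1 ≤ M) (φ : ι → Ω → ℂ) (hφ : ∀ j, ∀ᵐ x ∂μ, ‖φ j x‖ ≤ M)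
    (s : Finset ι) (a : ι → ℂ) :
    rademacherAverage (essSupNorm (Measure.pi fun _ : Fin k => μ)) (tensorSystem k φ) s a ≤
      ENNReal.ofReal (16 * (k : ℝ) ^ 2 * M ^ k) * rademacherAverage (essSupNorm μ) φ s a := by
  classical
  unfold rademacherAverage
  rw [← mul_div_assoc]
  refine ENNReal.div_le_div_right ?_ _
  let N : (s → ℤˣ) → ℝ≥0∞ := fun r =>
    essSupNorm μ fun x => ∑ j : s, ((r j : ℤ) : ℂ) * a j * φ j x
  -- Only finitely many almost-everywhere bounds are involved, so they hold together on a set `G` of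
  -- full measure. The pointwise estimate applies on `G`, and `G^k` has full product measure.
  let G : Set Ω := {x | (∀ j : s, ‖φ j x‖ ≤ M) ∧
    ∀ r : s → ℤˣ, ‖∑ j : s, ((r j : ℤ) : ℂ) * a j * φ j x‖ₑ ≤ N r}
  have hG : ∀ᵐ x ∂μ, x ∈ G := by
    refine (ae_all_iff.mpr fun j : s => hφ j).and (ae_all_iff.mpr fun r => ?_)
    simp only [N, essSupNorm, eLpNorm_exponent_top]
    exact ae_le_eLpNormEssSup
  have hGpi : ∀ᵐ x ∂(Measure.pi fun _ : Fin k => μ), ∀ i, x i ∈ G :=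
    ae_all_iff.mpr fun i => (Measure.tendsto_eval_ae_ae (μ := fun _ : Fin k => μ) (i := i)) hG
  obtain ⟨x₀, hx₀⟩ := hG.exists
  have : Nonempty G := ⟨⟨x₀, hx₀⟩⟩
  refine le_trans (Finset.sum_le_sum fun r _ => ?_)
    (sum_iSup_tensorSystem_le (X := G) k hk M hM s a (fun j x => φ j x)
      (fun j hj x => x.2.1 ⟨j, hj⟩) N fun r x => x.2.2 r)
  rw [essSupNorm, eLpNorm_exponent_top]
  refine essSup_le_of_ae_le _ (hGpi.mono fun x hx => ?_)
  exact le_iSup (fun y : Fin k → G =>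
    ‖∑ j : s, ((r j : ℤ) : ℂ) * a j * tensorSystem k (fun j (x : G) => φ j x) j y‖ₑ)
    (fun i => ⟨x i, hx i⟩)

theorem mainTheorem6 (k : ℕ) (hk : 1 ≤ k) (M c : ℝ) (hc : 0 < c) :
    ∃ γ : ℝ, 0 < γ ∧
      ∀ (ι : Type*) (Ω : Type*) [MeasurableSpace Ω] (μ : Measure Ω) [IsProbabilityMeasure μ]
        (φ : ι → Ω → ℂ), IsOrthonormalSystem μ φ →
        ((∀ j x, ‖φ j x‖ ≤ M) →
          IsRademacherSidonWith supNorm c (tensorSystem k φ) →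
          IsRademacherSidonWith supNorm γ φ) ∧
        ((∀ j, ∀ᵐ x ∂μ, ‖φ j x‖ ≤ M) →
          IsRademacherSidonWith (essSupNorm (Measure.pi fun _ : Fin k => μ)) c
            (tensorSystem k φ) →
          IsRademacherSidonWith (essSupNorm μ) γ φ) := by
  have hM : 1 ≤ max M 1 := le_max_right _ _
  have hC : 0 < 16 * (k : ℝ) ^ 2 * max M 1 ^ k := by
    have : (0 : ℝ) < k := by exact_mod_cast hk
    positivity
  refine ⟨c / (16 * (k : ℝ) ^ 2 * max M 1 ^ k), div_pos hc hC, ?_⟩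
  intro ι Ω _ μ _ φ _
  have : Nonempty Ω := nonempty_of_isProbabilityMeasure μ
  exact ⟨fun hφ h => h.of_le hC (rademacherAverage_supNorm_tensorSystem_le k hk _ hM φ
      fun j x => (hφ j x).trans (le_max_left _ _)),
    fun hφ h => h.of_le hC (rademacherAverage_essSupNorm_tensorSystem_le μ k hk _ hM φ
      fun j => (hφ j).mono fun x hx => hx.trans (le_max_left _ _))⟩
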